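/- Let $A$ be an alphabet, let $\#,a,b\in A$ be letters with $\#\neq a$ and $\#\neq b$, and let $x,y,z$ be three variables. A solution of a word equation $L=R$ with regular constraints is an assignment $\sigma$ of words over $A$ to the variables such that $\sigma(L)=\sigma(R)$ (where $\sigma$ is extended to a homomorphism fixing the letters of $A$) and $\sigma(v)\in\mathcal L$ for each constraint $v\in\mathcal L$. Its length abstraction is the set of the triples of lengths $(|\sigma(x)|,|\sigma(y)|,|\sigma(z)|)$ over all solutions $\sigma$. A word equation is regular if each variable occurs at most once on each side, and oriented if there is a total order on the variables such that on each side the variables occur in increasing order. The word equation $xz=zy$ (that is, $x$ and $y$ are conjugate) is regular and oriented. Together with the regular constraints $x\in\#(a+b)^*$ and $y\in\#(a+b)^*$, it has length abstraction $$\{(l_x,l_y,l_z)\in\mathbb N^3 : l_x=l_y,\ l_x>0,\ l_x\mid l_z\}.$$ Moreover, this length abstraction is not definable by a formula of Presburger arithmetic. -/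

import Mathlib

/-- A word equation `L = R` over the alphabet `A` with variables in `V`: both sides are words
over `A ∪ V`, a constant being tagged `Sum.inl` and a variable `Sum.inr`. -/
structure WordEquation (A V : Type*) where
  lhs : List (A ⊕ V)
  rhs : List (A ⊕ V)

/-- The homomorphism `(A ∪ V)* → A*` that fixes every constant and maps each variable `v`
to `σ v`. -/
def substWord {A V : Type*} (σ : V → List A) (w : List (A ⊕ V)) : List A :=
  w.flatMap (Sum.elim (fun c => [c]) σ)

/-- The sequence of variable occurrences of a word over `A ∪ V`, from left to right. -/
def varOccurrences {A V : Type*} (w : List (A ⊕ V)) : List V :=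
  w.filterMap Sum.getRight?

/-- A regular constraint `var ∈ lang`, where `lang` is a regular language over `A`. -/
structure RegularConstraint (A V : Type*) where
  var : V
  lang : Language A
  isRegular : lang.IsRegular

namespace WordEquation

variable {A V : Type*}

/-- Every variable occurs at most once on each side of the equation. -/
def IsRegular (E : WordEquation A V) : Prop :=
  (varOccurrences E.lhs).Nodup ∧ (varOccurrences E.rhs).Nodup

/-- Some total order on the variables is preserved by the variable occurrences on each side. -/
def IsOriented (E : WordEquation A V) : Prop :=
  ∃ lt : V → V → Prop, IsStrictTotalOrder V lt ∧
    (varOccurrences E.lhs).Pairwise lt ∧ (varOccurrences E.rhs).Pairwise lt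

/-- `σ` is a solution of the equation `E` with the set `S` of regular constraints. -/
def IsSolution (E : WordEquation A V) (S : Set (RegularConstraint A V)) (σ : V → List A) : Prop :=
  substWord σ E.lhs = substWord σ E.rhs ∧ ∀ c ∈ S, σ c.var ∈ c.lang

/-- The length abstraction of `(E, S)`: the set of all length tuples of solutions. -/
def lengthAbstraction (E : WordEquation A V) (S : Set (RegularConstraint A V)) : Set (V → ℕ) :=
  {n | ∃ σ : V → List A, E.IsSolution S σ ∧ n = fun v => (σ v).length}

end WordEquation

/-- A set of tuples of natural numbers is definable by a formula of Presburger arithmetic. -/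
def PresburgerDefinable {V : Type*} (s : Set (V → ℕ)) : Prop :=
  (∅ : Set ℕ).Definable FirstOrder.Language.presburger s

/-- The three variables `x`, `y`, `z`. -/
inductive XYZ : Type
  | x | y | z
  deriving DecidableEq

/-- The word equation `x z = z y`. -/
def conjugacyEquation (A : Type*) : WordEquation A XYZ where
  lhs := [Sum.inr XYZ.x, Sum.inr XYZ.z]
  rhs := [Sum.inr XYZ.z, Sum.inr XYZ.y]

open scoped Computability in
/-- The language `#(a + b)*`. -/
def hashLanguage {A : Type*} (hash a b : A) : Language A :=
  ({[hash]} : Language A) * (({[a]} : Language A) + {[b]})∗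

theorem mem_hashLanguage {A : Type*} {hash a b : A} {w : List A} :
    w ∈ hashLanguage hash a b ↔ ∃ u : List A, (∀ c ∈ u, c = a ∨ c = b) ∧ w = hash :: u := by
  unfold hashLanguage
  rw [Language.mem_mul]
  constructor
  · rintro ⟨p, hp, u, hu, rfl⟩
    obtain rfl : p = [hash] := hp
    refine ⟨u, ?_, rfl⟩
    obtain ⟨L, rfl, hL⟩ := Language.mem_kstar.1 hu
    intro c hc
    obtain ⟨y, hy, hcy⟩ := List.mem_flatten.1 hc
    rcases hL y hy with h | h
    · obtain rfl : y = [a] := h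
      exact Or.inl (by simpa using hcy)
    · obtain rfl : y = [b] := h
      exact Or.inr (by simpa using hcy)
  · rintro ⟨u, hu, rfl⟩
    refine ⟨[hash], rfl, u, ?_, rfl⟩
    refine Language.mem_kstar.2 ⟨u.map (fun c => [c]), ?_, ?_⟩
    · induction u with
      | nil => rfl
      | cons c u ih => simpa using ih fun d hd => hu d (List.mem_cons_of_mem _ hd)
    · intro y hy
      obtain ⟨c, hc, rfl⟩ := List.mem_map.1 hy
      rcases hu c hc with rfl | rfl
      · exact Or.inl rfl
      · exact Or.inr rfl

theorem hashLanguage_isRegular {A : Type*} (hash a b : A) : (hashLanguage hash a b).IsRegular := by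
  classical
  let M : DFA A (Option Bool) :=
    { step := fun s c => match s with
        | some false => if c = hash then some true else none
        | some true => if c = a ∨ c = b then some true else none
        | none => none
      start := some false
      accept := {some true} }
  have h0 : ∀ u : List A, M.evalFrom none u = none := by
    intro u
    induction u with
    | nil => rfl
    | cons c u ih => exact ih
  have h1 : ∀ u : List A, M.evalFrom (some true) u = some true ↔ ∀ c ∈ u, c = a ∨ c = b := by
    intro u
    induction u with
    | nil => simp
    | cons c u ih =>
      change M.evalFrom (if c = a ∨ c = b then some true else none) u = some true ↔ _
      by_cases hc : c = a ∨ c = b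
      · rw [if_pos hc, ih]
        simp [hc]
      · rw [if_neg hc, h0]
        simp [hc]
  refine Language.isRegular_iff.2 ⟨Option Bool, inferInstance, M, ?_⟩
  ext w
  rw [mem_hashLanguage, DFA.mem_accepts]
  change M.evalFrom (some false) w = some true ↔ _
  cases w with
  | nil => simp
  | cons c u =>
    change M.evalFrom (if c = hash then some true else none) u = some true ↔ _
    by_cases hc : c = hash
    · rw [if_pos hc, h1]
      simp [hc]
    · rw [if_neg hc, h0]
      simp [hc]

/-- The regular constraints `x ∈ #(a + b)*` and `y ∈ #(a + b)*`. -/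
def hashConstraints {A : Type*} (hash a b : A) : Set (RegularConstraint A XYZ) :=
  {⟨XYZ.x, hashLanguage hash a b, hashLanguage_isRegular hash a b⟩,
   ⟨XYZ.y, hashLanguage hash a b, hashLanguage_isRegular hash a b⟩}

/-! Stripping prefixes `x` from `z` in `xz = zy` leaves a remainder that must be empty or `x`
itself, as otherwise `#` would reappear inside `y`; so `z` is a power of `x`. Conversely, `x = y =
#aⁱ` and `z = xᵏ` realise every triple. Presburger sets are finite unions of linear sets. Along a
ray `a + kp`, divisibility for all `k` with `p.x > 0` forces `a` and `p` to have the same `z/x`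
ratio. Hence each linear piece contains points `(m, m, m²)` only for bounded `m`, yet all `m > 0`
occur. -/

instance : Finite XYZ :=
  Finite.of_surjective (fun i : Fin 3 => match i with | 0 => XYZ.x | 1 => XYZ.y | 2 => XYZ.z)
    fun v => by
      cases v
      exacts [⟨0, rfl⟩, ⟨1, rfl⟩, ⟨2, rfl⟩]

theorem conjugacyEquation_isRegular (A : Type*) : (conjugacyEquation A).IsRegular := by
  simp [WordEquation.IsRegular, conjugacyEquation, varOccurrences]

/-- The position of a variable in the order `x < z < y`. -/
def XYZ.rank : XYZ → ℕ
  | .x => 0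
  | .z => 1
  | .y => 2

theorem XYZ.rank_injective : Function.Injective XYZ.rank := by
  intro u v h
  cases u <;> cases v <;> first | rfl | simp [XYZ.rank] at h

theorem conjugacyEquation_isOriented (A : Type*) : (conjugacyEquation A).IsOriented := by
  refine ⟨fun u v => u.rank < v.rank,
    (RelEmbedding.preimage ⟨_, XYZ.rank_injective⟩ (· < ·)).isStrictTotalOrder, ?_, ?_⟩ <;>
  simp [conjugacyEquation, varOccurrences, XYZ.rank]

/-- If `x` and `y` both start with a letter that does not occur again in `y`, then `x z = z y`
forces `z` to be a power of `x`, so that `|x|` divides `|z|`. -/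
theorem length_dvd_of_append_eq_append {A : Type*} {c : A} {u v : List A} (hv : c ∉ v)
    (z : List A) (h : (c :: u) ++ z = z ++ (c :: v)) : (c :: u).length ∣ z.length := by
  induction hn : z.length using Nat.strong_induction_on generalizing z with
  | _ n ih =>
    subst hn
    -- Either `z = x z'` and `z'` solves the same equation, or `x = z w` and `y = w z`. In the
    -- second case, if `z` and `w` are nonempty, the first letter `c` of `z` recurs in `v`.
    rcases List.append_eq_append_iff.1 h with ⟨z', hz, hz'⟩ | ⟨w, hx, hy⟩
    · have hlt : z'.length < z.length := by simp [hz]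
      have := ih _ hlt z' (by rw [← hz']; exact hz.symm) rfl
      rw [hz, List.length_append]
      exact (dvd_refl _).add this
    · cases z with
      | nil => simp
      | cons d z =>
        obtain ⟨rfl, -⟩ := List.cons.inj hx
        cases w with
        | nil => simp [hx]
        | cons e w =>
          obtain ⟨-, rfl⟩ := List.cons.inj hy
          simp at hv

theorem replicate_flatten_append_comm {A : Type*} (w : List A) (k : ℕ) :
    w ++ (List.replicate k w).flatten = (List.replicate k w).flatten ++ w := by
  rw [← List.flatten_cons, ← List.replicate_succ, List.replicate_succ', List.flatten_append]
  simp

theorem conjugacyEquation_isSolution_iff {A : Type*} {hash a b : A} {σ : XYZ → List A} :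
    (conjugacyEquation A).IsSolution (hashConstraints hash a b) σ ↔
      σ .x ++ σ .z = σ .z ++ σ .y ∧
        σ .x ∈ hashLanguage hash a b ∧ σ .y ∈ hashLanguage hash a b := by
  simp [WordEquation.IsSolution, conjugacyEquation, hashConstraints, substWord]

theorem lengthAbstraction_conjugacyEquation {A : Type*} {hash a b : A} (ha : hash ≠ a)
    (hb : hash ≠ b) :
    (conjugacyEquation A).lengthAbstraction (hashConstraints hash a b) =
      {n : XYZ → ℕ | n .x = n .y ∧ 0 < n .x ∧ n .x ∣ n .z} := by
  ext n
  constructor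
  · rintro ⟨σ, hσ, rfl⟩
    obtain ⟨h, hx, hy⟩ := conjugacyEquation_isSolution_iff.1 hσ
    obtain ⟨u, -, hu⟩ := mem_hashLanguage.1 hx
    obtain ⟨v, hv, hv'⟩ := mem_hashLanguage.1 hy
    have hlen := congrArg List.length h
    simp only [List.length_append] at hlen
    refine ⟨by dsimp only; omega, by simp [hu], ?_⟩
    rw [hu, hv'] at h
    dsimp only
    rw [hu]
    exact length_dvd_of_append_eq_append (fun hc => (hv _ hc).elim ha hb) _ h
  · rintro ⟨hxy, hpos, k, hk⟩
    let w := hash :: List.replicate (n .x - 1) a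
    have hw : w.length = n .x := by simp [w]; omega
    have hmem : w ∈ hashLanguage hash a b :=
      mem_hashLanguage.2 ⟨_, fun c hc => Or.inl (List.eq_of_mem_replicate hc), rfl⟩
    refine ⟨fun | .x => w | .y => w | .z => (List.replicate k w).flatten,
      conjugacyEquation_isSolution_iff.2 ⟨replicate_flatten_append_comm w k, hmem, hmem⟩, ?_⟩
    funext v
    cases v
    · exact hw.symm
    · exact hxy.symm.trans hw.symm
    · simp [hw, hk, mul_comm]

/-- A tuple of lengths with a square ratio in a linear set on which `n x ∣ n z` is bounded by the
base point of the linear set. -/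
theorem IsLinearSet.bddAbove_of_dvd {s : Set (XYZ → ℕ)} (hs : IsLinearSet s)
    (hdvd : ∀ n ∈ s, 0 < n .x ∧ n .x ∣ n .z) :
    BddAbove {m : ℕ | ∃ n ∈ s, n .x = m ∧ n .z = m * m} := by
  obtain ⟨a, t, -, rfl⟩ := hs
  refine ⟨max (a .x) (a .z), ?_⟩
  rintro m ⟨n, ⟨p, hp, rfl⟩, hx, hz⟩
  -- The whole ray `a + kp` stays in the linear set.
  have hline : ∀ k : ℕ, 0 < a .x + k * p .x ∧ a .x + k * p .x ∣ a .z + k * p .z := fun k => by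
    simpa using hdvd _ ⟨k • p, AddSubmonoid.nsmul_mem _ hp k, rfl⟩
  replace hx : a .x + p .x = m := hx
  replace hz : a .z + p .z = m * m := hz
  have ha : 0 < a .x := by simpa using (hline 0).1
  rcases Nat.eq_zero_or_pos (p .x) with h0 | hpos
  · exact le_max_of_le_left (by omega)
  apply le_max_of_le_right
  -- Eliminating `k` leaves a determinant independent of `k`.
  have hconst : ∀ k : ℕ, ((a .x + k * p .x : ℕ) : ℤ) ∣ p .x * a .z - p .z * a .x := fun k => by
    have h := Int.natCast_dvd_natCast.2 (hline k).2
    have heq : (p .x * a .z - p .z * a .x : ℤ) =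
        p .x * ((a .z + k * p .z : ℕ) : ℤ) - p .z * ((a .x + k * p .x : ℕ) : ℤ) := by
      push_cast
      ring
    rw [heq]
    exact (h.mul_left _).sub (dvd_mul_left _ _)
  have hzero : (p .x * a .z - p .z * a .x : ℤ) = 0 := by
    set d : ℤ := p .x * a .z - p .z * a .x
    -- At `k = |d|` the divisor already exceeds `|d|`.
    refine Int.eq_zero_of_abs_lt_dvd (hconst d.natAbs) ?_
    rw [Int.abs_eq_natAbs]
    have := Nat.le_mul_of_pos_right d.natAbs hpos
    exact_mod_cast (by omega : d.natAbs < a .x + d.natAbs * p .x)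
  -- Proportionality to `(m, m²)` gives `a.z = m * a.x ≥ m`.
  have hratio : m * (a .x * m) = m * a .z := by
    zify at hx hz ⊢
    linear_combination -hzero + (a .z : ℤ) * hx - (a .x : ℤ) * hz
  rw [← Nat.eq_of_mul_eq_mul_left (by omega) hratio]
  exact Nat.le_mul_of_pos_left m ha

theorem not_presburgerDefinable_dvd :
    ¬ PresburgerDefinable {n : XYZ → ℕ | n .x = n .y ∧ 0 < n .x ∧ n .x ∣ n .z} := by
  intro h
  obtain ⟨S, hfin, hlin, hS⟩ :=
    FirstOrder.Language.presburger.definable_iff_isSemilinearSet.1 h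
  have hbdd : BddAbove (⋃ s ∈ S, {m : ℕ | ∃ n ∈ s, n XYZ.x = m ∧ n XYZ.z = m * m}) := by
    refine hfin.bddAbove_biUnion.2 fun s hs => (hlin s hs).bddAbove_of_dvd fun n hn => ?_
    have hn' : n ∈ ⋃₀ S := ⟨s, hs, hn⟩
    rw [← hS] at hn'
    exact hn'.2
  obtain ⟨B, hB⟩ := hbdd
  let n : XYZ → ℕ := fun | .x => B + 1 | .y => B + 1 | .z => (B + 1) * (B + 1)
  have hn : n ∈ ⋃₀ S := hS ▸ ⟨rfl, Nat.succ_pos B, dvd_mul_left _ _⟩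
  obtain ⟨s, hs, hns⟩ := hn
  exact absurd (hB (Set.mem_biUnion hs ⟨n, hns, rfl, rfl⟩)) (Nat.not_succ_le_self B)

theorem mainTheorem8 {A : Type*} (hash a b : A) (ha : hash ≠ a) (hb : hash ≠ b) :
    (conjugacyEquation A).IsRegular ∧ (conjugacyEquation A).IsOriented ∧
    (conjugacyEquation A).lengthAbstraction (hashConstraints hash a b) =
      {n : XYZ → ℕ | n XYZ.x = n XYZ.y ∧ 0 < n XYZ.x ∧ n XYZ.x ∣ n XYZ.z} ∧
    ¬ PresburgerDefinable
      ((conjugacyEquation A).lengthAbstraction (hashConstraints hash a b)) := by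
  refine ⟨conjugacyEquation_isRegular A, conjugacyEquation_isOriented A,
    lengthAbstraction_conjugacyEquation ha hb, ?_⟩
  rw [lengthAbstraction_conjugacyEquation ha hb]
  exact not_presburgerDefinable_dvd
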